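/- Let \(V\) be a finite-dimensional real vector space with a non-degenerate quadratic form \(Q\) of arbitrary signature and associated symmetric bilinear form \(B(u,v)=\frac12[Q(u+v)-Q(u)-Q(v)]\). Let \(\mathrm{Cl}(V)\) be the universal Clifford algebra of \((V,Q)\) with the sign convention \(v^2=-Q(v)\) for \(v\in V\subset \mathrm{Cl}(V)\); let \(\tilde{\ }\) denote the reversal (\(\widetilde{v_1\cdots v_k}=v_k\cdots v_1\)) and \(\hat{\ }\) the grade involution (\(\widehat{v_1\cdots v_k}=(-1)^k v_1\cdots v_k\)). The Lipschitz group \(\Gamma(V)\) consists of the invertible \(g\in\mathrm{Cl}(V)\) with \(g x \hat g^{-1}\in V\) for all \(x\in V\). Equip \(V\oplus\mathbb{R}^{1,1}\) with the form \(\hat Q(v+x_-e_-+x_+e_+)=Q(v)-x_-^2+x_+^2\), and identify \(\mathrm{Cl}(V\oplus\mathbb{R}^{1,1})\) with \(\mathrm{Mat}(2,\mathrm{Cl}(V))\) by the algebra isomorphism that extends \[ v+x_-e_-+x_+e_+\ \mapsto\ \begin{pmatrix} v & x_--x_+\\ x_-+x_+ & -v\end{pmatrix}. \] A matrix \(A=\begin{pmatrix}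 a&b\\c&d\end{pmatrix}\in\mathrm{Mat}(2,\mathrm{Cl}(V))\) is called a Vahlen matrix if it lies in \(\Gamma(V\oplus\mathbb{R}^{1,1})\); its pseudo-determinant is \(\Delta(A)=a\tilde d-b\tilde c\). Lemma. Let \(A=\begin{pmatrix} a&b\\c&d\end{pmatrix}\) be a Vahlen matrix, and let \(V_A=\{x\in V:\ cx+d \text{ is invertible in } \mathrm{Cl}(V)\}\). Then \(V_A\) is open, \(Ax:=(ax+b)(cx+d)^{-1}\) lies in \(V\) for every \(x\in V_A\), and \(x\mapsto Ax\) is smooth on \(V_A\). Moreover \(\Delta(A)\) is a non-zero real number, \((x\tilde c+\tilde d)(cx+d)\) is a non-zero real number for every \(x\in V_A\), the function \[ \Omega_A(x)=\frac{\Delta(A)}{(x\tilde c+\tilde d)(cx+d)} \] is smooth on \(V_A\), and the pull-back of \(B\) satisfies \[ A^*B=\Omega_A^2\,B \quad\text{on } V_A, \] that is, \(B(dA_x u,dA_x v)=\Omega_A(x)^2B(u,v)\) for all \(x\in V_A\) and \(u,v\in V\), where \(dA_x\) is the derivative of \(x\mapsto Ax\) at \(x\). In particular, for every non-empty connected open set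 \(U\subseteq V_A\), the map \(U\to V\), \(x\mapsto Ax\), is a conformal transformation: it is smooth and its pull-back of \(B\) equals \(\Omega^2B\) for some smooth function \(\Omega:U\to(0,\infty)\). -/

import Mathlib

open scoped ContDiff Matrix

noncomputable section

/-- The real Clifford algebra of `(V, Q)` with the sign convention `v * v = -Q v`. -/
abbrev Cl {V : Type*} [AddCommGroup V] [Module ℝ V] (Q : QuadraticForm ℝ V) : Type _ :=
  CliffordAlgebra (-Q)

/-- The inclusion of `V` into `Cl Q`. -/
abbrev Cl.vec {V : Type*} [AddCommGroup V] [Module ℝ V] (Q : QuadraticForm ℝ V) :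
    V →ₗ[ℝ] Cl Q :=
  CliffordAlgebra.ι (-Q)

/-- The reversal on `Cl Q`: `v₁ ⋯ vₖ ↦ vₖ ⋯ v₁`. -/
abbrev Cl.rev {V : Type*} [AddCommGroup V] [Module ℝ V] (Q : QuadraticForm ℝ V) :
    Cl Q →ₗ[ℝ] Cl Q :=
  CliffordAlgebra.reverse

/-- The grade involution on `Cl Q`: `v₁ ⋯ vₖ ↦ (-1)ᵏ v₁ ⋯ vₖ`. -/
abbrev Cl.grade {V : Type*} [AddCommGroup V] [Module ℝ V] (Q : QuadraticForm ℝ V) :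
    Cl Q →ₐ[ℝ] Cl Q :=
  CliffordAlgebra.involute

/-- The Lipschitz group: the invertible `g` such that the twisted adjoint action
`x ↦ g x (ĝ)⁻¹` maps `V` to `V`, where `ĝ` is the grade involution of `g`. -/
def LipschitzSet {V : Type*} [AddCommGroup V] [Module ℝ V] (Q : QuadraticForm ℝ V) :
    Set (Cl Q)ˣ :=
  {g | ∀ x : V, ∃ y : V,
    (g : Cl Q) * Cl.vec Q x * ((Units.map (Cl.grade Q : Cl Q →* Cl Q) g)⁻¹ : (Cl Q)ˣ)
      = Cl.vec Q y}

/-- The form `Q(v) - (x₋)² + (x₊)²` on `V ⊕ ℝ^{1,1}`; the element `v + x₋ e₋ + x₊ e₊` is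
the triple `(v, x₋, x₊)`. -/
def hatQ {V : Type*} [AddCommGroup V] [Module ℝ V] (Q : QuadraticForm ℝ V) :
    QuadraticForm ℝ (V × ℝ × ℝ) :=
  QuadraticMap.prod Q (QuadraticMap.prod (-QuadraticMap.sq) QuadraticMap.sq)

theorem hatQ_apply {V : Type*} [AddCommGroup V] [Module ℝ V] (Q : QuadraticForm ℝ V)
    (x : V × ℝ × ℝ) : hatQ Q x = Q x.1 - x.2.1 ^ 2 + x.2.2 ^ 2 := by
  simp [hatQ]
  ring

/-- The Clifford map `V ⊕ ℝ^{1,1} → Mat(2, Cl(V))`, with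
`v ↦ diag(v, -v)`, `e₋ ↦ (0 1; 1 0)`, `e₊ ↦ (0 -1; 1 0)`. -/
def jVec {V : Type*} [AddCommGroup V] [Module ℝ V] (Q : QuadraticForm ℝ V) :
    V × ℝ × ℝ →ₗ[ℝ] Matrix (Fin 2) (Fin 2) (Cl Q) where
  toFun x := !![Cl.vec Q x.1, algebraMap ℝ (Cl Q) (x.2.1 - x.2.2);
                algebraMap ℝ (Cl Q) (x.2.1 + x.2.2), -Cl.vec Q x.1]
  map_add' x y := by
    ext i k
    fin_cases i <;> fin_cases k <;> simp <;> abel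
  map_smul' r x := by
    ext i k
    fin_cases i <;> fin_cases k <;>
      simp [Algebra.smul_def, mul_sub, mul_add]

theorem jVec_sq {V : Type*} [AddCommGroup V] [Module ℝ V] (Q : QuadraticForm ℝ V)
    (x : V × ℝ × ℝ) :
    jVec Q x * jVec Q x = algebraMap ℝ (Matrix (Fin 2) (Fin 2) (Cl Q)) ((-hatQ Q) x) := by
  have h : Cl.vec Q x.1 * Cl.vec Q x.1 = algebraMap ℝ (Cl Q) (-Q x.1) := by
    exact CliffordAlgebra.ι_sq_scalar (-Q) x.1
  have c (r : ℝ) : Cl.vec Q x.1 * algebraMap ℝ (Cl Q) r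
      = algebraMap ℝ (Cl Q) r * Cl.vec Q x.1 := (Algebra.commutes r _).symm
  rw [neg_apply, hatQ_apply, Algebra.algebraMap_eq_smul_one]
  ext i k
  fin_cases i <;> fin_cases k <;>
    simp only [jVec, LinearMap.coe_mk, AddHom.coe_mk, Matrix.mul_apply, Fin.sum_univ_two,
      Matrix.smul_apply, Matrix.one_apply, Matrix.of_apply, Matrix.cons_val', Matrix.cons_val_zero,
      Matrix.cons_val_one, Fin.zero_eta, Fin.mk_one, Matrix.cons_val_fin_one, if_true,
      ← Algebra.algebraMap_eq_smul_one, neg_mul_neg, h, ← map_mul, ← map_add]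
  · congr 1; ring
  · rw [mul_neg, c, add_neg_cancel]; simp
  · rw [neg_mul, c, add_neg_cancel]; simp
  · congr 1; ring

/-- The canonical algebra map `Cl(V ⊕ ℝ^{1,1}) → Mat(2, Cl(V))` extending `jVec`; it is used to
regard elements of `Cl(V ⊕ ℝ^{1,1})` as matrices. -/
def jHat {V : Type*} [AddCommGroup V] [Module ℝ V] (Q : QuadraticForm ℝ V) :
    Cl (hatQ Q) →ₐ[ℝ] Matrix (Fin 2) (Fin 2) (Cl Q) :=
  CliffordAlgebra.lift (-hatQ Q) ⟨jVec Q, jVec_sq Q⟩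

/-- A Vahlen matrix: an element of the Lipschitz group of `V ⊕ ℝ^{1,1}`, written as a matrix. -/
def IsVahlen {V : Type*} [AddCommGroup V] [Module ℝ V] (Q : QuadraticForm ℝ V)
    (A : Matrix (Fin 2) (Fin 2) (Cl Q)) : Prop :=
  ∃ g ∈ LipschitzSet (hatQ Q), jHat Q (g : Cl (hatQ Q)) = A

/-- The pseudo-determinant `Δ(A) = a d̃ - b c̃`. -/
def pseudoDet {V : Type*} [AddCommGroup V] [Module ℝ V] (Q : QuadraticForm ℝ V)
    (A : Matrix (Fin 2) (Fin 2) (Cl Q)) : Cl Q :=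
  A 0 0 * Cl.rev Q (A 1 1) - A 0 1 * Cl.rev Q (A 1 0)

/-- The numerator `a x + b`. -/
def moebiusNum {V : Type*} [AddCommGroup V] [Module ℝ V] (Q : QuadraticForm ℝ V)
    (A : Matrix (Fin 2) (Fin 2) (Cl Q)) (x : V) : Cl Q :=
  A 0 0 * Cl.vec Q x + A 0 1

/-- The denominator `c x + d`. -/
def moebiusDen {V : Type*} [AddCommGroup V] [Module ℝ V] (Q : QuadraticForm ℝ V)
    (A : Matrix (Fin 2) (Fin 2) (Cl Q)) (x : V) : Cl Q :=
  A 1 0 * Cl.vec Q x + A 1 1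

/-- The set of `x : V` for which `c x + d` is invertible. -/
def moebiusDomain {V : Type*} [AddCommGroup V] [Module ℝ V] (Q : QuadraticForm ℝ V)
    (A : Matrix (Fin 2) (Fin 2) (Cl Q)) : Set V :=
  {x | IsUnit (moebiusDen Q A x)}

/-- The vector of `V` equal to `(a x + b) (c x + d)⁻¹` in `Cl Q` (arbitrary if there is none). -/
def moebiusMap {V : Type*} [AddCommGroup V] [Module ℝ V] (Q : QuadraticForm ℝ V)
    (A : Matrix (Fin 2) (Fin 2) (Cl Q)) (x : V) : V :=
  Function.invFun (Cl.vec Q) (moebiusNum Q A x * Ring.inverse (moebiusDen Q A x))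

/-- The element `(x c̃ + d̃) (c x + d)`. -/
def conformalDen {V : Type*} [AddCommGroup V] [Module ℝ V] (Q : QuadraticForm ℝ V)
    (A : Matrix (Fin 2) (Fin 2) (Cl Q)) (x : V) : Cl Q :=
  (Cl.vec Q x * Cl.rev Q (A 1 0) + Cl.rev Q (A 1 1)) * (A 1 0 * Cl.vec Q x + A 1 1)

/-- The real number `Ω_A(x)` equal to `Δ(A) / ((x c̃ + d̃) (c x + d))` in `Cl Q`
(arbitrary if there is none). -/
def conformalFactor {V : Type*} [AddCommGroup V] [Module ℝ V] (Q : QuadraticForm ℝ V)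
    (A : Matrix (Fin 2) (Fin 2) (Cl Q)) (x : V) : ℝ :=
  Function.invFun (algebraMap ℝ (Cl Q)) (pseudoDet Q A * Ring.inverse (conformalDen Q A x))

/-- The symmetric bilinear form `B(u, v) = (Q(u + v) - Q(u) - Q(v)) / 2`. -/
def formB {V : Type*} [AddCommGroup V] [Module ℝ V] (Q : QuadraticForm ℝ V) :
    LinearMap.BilinForm ℝ V :=
  QuadraticMap.associated Q

/-- The pull-back `(φ^*B)_x (u, v) = B(dφ_x u, dφ_x v)`. -/
def pullbackB {V : Type*} [NormedAddCommGroup V] [NormedSpace ℝ V] (Q : QuadraticForm ℝ V)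
    (φ : V → V) (x : V) : LinearMap.BilinForm ℝ V :=
  (formB Q).comp (fderiv ℝ φ x : V →ₗ[ℝ] V) (fderiv ℝ φ x : V →ₗ[ℝ] V)

/-- `φ : U → V` is a conformal transformation of `(V, Q)`: `U` is a non-empty connected open set,
`φ` is smooth on `U`, and `φ^*B = Ω² B` for some smooth `Ω : U → (0, ∞)`. -/
structure IsConformalTransformation {V : Type*} [NormedAddCommGroup V] [NormedSpace ℝ V]
    (Q : QuadraticForm ℝ V) (U : Set V) (φ : V → V) : Prop where
  isOpen : IsOpen U
  isConnected : IsConnected U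
  smooth : ContDiffOn ℝ ∞ φ U
  exists_factor : ∃ Ω : V → ℝ, ContDiffOn ℝ ∞ Ω U ∧ (∀ x ∈ U, 0 < Ω x) ∧
    ∀ x ∈ U, pullbackB Q φ x = Ω x ^ 2 • formB Q

end

/-! A point `x` of `V` is lifted to a null vector `X` of `V ⊕ ℝ^{1,1}`, normalised by `x₋ + x₊ = 1`.
A Vahlen matrix comes from a Lipschitz element `g`, whose twisted action is a linear isometry `L` of
`V ⊕ ℝ^{1,1}`. The matrix of `X` has rank one: it is the column `(x, 1)` times the row `(1, -x)`.
Hence the first column of `g X g̃` is `(ax + b, cx + d)` times the Clifford conjugate of `cx + d`,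
and this equals a scalar times the first column of `L X` (`moebius_mul_conj`). So `Ax` is the
`V`-component of `L X` divided by `τ(x)`, the sum of its last two coordinates, and `τ` vanishes
exactly off the domain.

The scalars come from the twisted centre: with a nondegenerate form, `v a = â v` for all `v` forces
`a` to be real (`mem_range_of_twisted_commute`). This gives `lipschitz_norm`, whose value is the
pseudo-determinant, and `lipschitz_grade_eq`, by which conjugate and reversal agree up to sign.

Since `Q̂(X - Y) = Q(x - y)` and `L` is an isometry, `Q(Ay - Ax) = τ(x)⁻¹ τ(y)⁻¹ Q(y - x)`. Letting
`y` tend to `x` along lines and polarising gives the pull-back formula. -/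

namespace CliffordAlgebra

/-! ### Contractions and the twisted centre of a Clifford algebra. -/

/-- The operator `a ↦ ∑ i, eᵢ * (eⁱ ⌋ a)` on the exterior algebra, for a basis `e`. -/
noncomputable def eulerOperator {ι R M : Type*} [Fintype ι] [CommRing R] [AddCommGroup M] [Module R M]
    (b : Module.Basis ι R M) : ExteriorAlgebra R M →ₗ[R] ExteriorAlgebra R M :=
  ∑ i, LinearMap.mulLeft R (CliffordAlgebra.ι (0 : QuadraticForm R M) (b i)) ∘ₗ
    contractLeft (b.coord i)

section

variable {ι R M : Type*} [Fintype ι] [CommRing R] [AddCommGroup M] [Module R M]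
  (b : Module.Basis ι R M)

theorem eulerOperator_apply (a : ExteriorAlgebra R M) :
    eulerOperator b a = ∑ i, CliffordAlgebra.ι (0 : QuadraticForm R M) (b i) *
      contractLeft (b.coord i) a := by
  simp [eulerOperator]

/-- Contraction is an antiderivation and `eᵢ v = -v eᵢ`, so the two signs cancel; the extra term is
the basis expansion of `v`. -/
theorem eulerOperator_ι_mul (v : M) (a : ExteriorAlgebra R M) :
    eulerOperator b (ExteriorAlgebra.ι R v * a) =
      ExteriorAlgebra.ι R v * a + ExteriorAlgebra.ι R v * eulerOperator b a := by
  have hv : ExteriorAlgebra.ι R v = ∑ i, (b.coord i) v • ExteriorAlgebra.ι R (b i) := by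
    conv_lhs => rw [← b.sum_repr v, map_sum]
    simp only [map_smul, Module.Basis.coord_apply]
  have anti (i) : ExteriorAlgebra.ι R (b i) * ExteriorAlgebra.ι R v =
      -(ExteriorAlgebra.ι R v * ExteriorAlgebra.ι R (b i)) :=
    eq_neg_of_add_eq_zero_left (ExteriorAlgebra.ι_add_mul_swap _ _)
  simp only [eulerOperator_apply, contractLeft_ι_mul, mul_sub, Finset.sum_sub_distrib,
    Finset.mul_sum]
  rw [sub_eq_add_neg, ← Finset.sum_neg_distrib]
  congr 1
  · conv_rhs => rw [hv]
    simp [Finset.sum_mul]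
  · refine Finset.sum_congr rfl fun i _ => ?_
    rw [← mul_assoc, anti, neg_mul, neg_neg, mul_assoc]

theorem eulerOperator_of_mem (n : ℕ) {a : ExteriorAlgebra R M} (ha : a ∈ ⋀[R]^n M) :
    eulerOperator b a = n • a := by
  induction ha using Submodule.pow_induction_on_left' with
  | algebraMap r =>
    rw [eulerOperator_apply, zero_smul]
    exact Finset.sum_eq_zero fun i _ => by rw [contractLeft_algebraMap, mul_zero]
  | add x y i _ _ hx hy => rw [map_add, hx, hy, smul_add]
  | mem_mul m hm i x _ hx =>
    obtain ⟨v, rfl⟩ := hm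
    rw [eulerOperator_ι_mul, hx, mul_smul_comm, Nat.succ_eq_add_one, add_smul, one_smul, add_comm]

end

/-- The Euler operator multiplies degree `n` by `n` and here kills `a`, so in characteristic zero
only the degree-zero component survives. -/
theorem exterior_mem_range_of_contractLeft_eq_zero {K M : Type*} [Field K] [CharZero K]
    [AddCommGroup M] [Module K M] [FiniteDimensional K M] {a : ExteriorAlgebra K M}
    (h : ∀ d : Module.Dual K M, contractLeft (Q := (0 : QuadraticForm K M)) d a = 0) :
    ∃ r : K, a = algebraMap K _ r := by
  let b := Module.finBasis K M
  have hE : eulerOperator b a = 0 := by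
    rw [eulerOperator_apply]
    exact Finset.sum_eq_zero fun i _ => by rw [h, mul_zero]
  have key (n : ℕ) : ((DirectSum.decompose (fun i : ℕ => ⋀[K]^i M) (eulerOperator b a)) n :
      ExteriorAlgebra K M) = n • (DirectSum.decompose (fun i : ℕ => ⋀[K]^i M) a n :
        ExteriorAlgebra K M) := by
    clear h hE
    induction a using DirectSum.Decomposition.inductionOn (fun i : ℕ => ⋀[K]^i M) with
    | zero => simp
    | add x y hx hy => simp [DirectSum.decompose_add, hx, hy]
    | @homogeneous i m =>
      rw [eulerOperator_of_mem b i m.2]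
      by_cases hi : i = n
      · subst hi
        rw [← AddSubmonoidClass.coe_nsmul, DirectSum.decompose_coe, DirectSum.decompose_coe,
          DirectSum.of_eq_same, DirectSum.of_eq_same, AddSubmonoidClass.coe_nsmul]
      · rw [← AddSubmonoidClass.coe_nsmul, DirectSum.decompose_coe, DirectSum.decompose_coe,
          DirectSum.of_eq_of_ne _ _ _ (Ne.symm hi), DirectSum.of_eq_of_ne _ _ _ (Ne.symm hi)]
        simp
  have hz (n : ℕ) (hn : n ≠ 0) : (DirectSum.decompose (fun i : ℕ => ⋀[K]^i M) a n :
      ExteriorAlgebra K M) = 0 := by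
    have := key n
    rw [hE, DirectSum.decompose_zero, ← Nat.cast_smul_eq_nsmul K] at this
    exact (smul_eq_zero.mp this.symm).resolve_left (Nat.cast_ne_zero.mpr hn)
  have ha : a = (DirectSum.decompose (fun i : ℕ => ⋀[K]^i M) a 0 : ExteriorAlgebra K M) := by
    classical
    conv_lhs => rw [← DirectSum.sum_support_decompose (fun i : ℕ => ⋀[K]^i M) a]
    refine Finset.sum_eq_single 0 (fun n _ hn => hz n hn) fun h0 => ?_
    simpa using h0
  have := (DirectSum.decompose (fun i : ℕ => ⋀[K]^i M) a 0).2
  rw [← ha] at this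
  simp only [pow_zero] at this
  obtain ⟨r, hr⟩ := Submodule.mem_one.mp this
  exact ⟨r, hr.symm⟩

theorem mem_range_of_contractLeft_eq_zero {K M : Type*} [Field K] [CharZero K]
    [AddCommGroup M] [Module K M] [FiniteDimensional K M] {Q : QuadraticForm K M}
    {a : CliffordAlgebra Q} (h : ∀ d : Module.Dual K M, contractLeft d a = 0) :
    ∃ r : K, a = algebraMap K _ r := by
  let _ : Invertible (2 : K) := invertibleOfNonzero two_ne_zero
  obtain ⟨r, hr⟩ := exterior_mem_range_of_contractLeft_eq_zero (a := equivExterior Q a) fun d => by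
    rw [equivExterior]
    exact (changeForm_contractLeft changeForm.associated_neg_proof d a).symm.trans
      (by rw [h, map_zero])
  refine ⟨r, (equivExterior Q).injective ?_⟩
  rw [hr]
  exact (changeForm_algebraMap changeForm.associated_neg_proof r).symm

/-- Both sides obey the same recursion under left multiplication by a vector. Twisted commutation
thereby becomes vanishing of contractions, and nondegeneracy supplies every contraction. -/
theorem ι_mul_sub_involute_mul_ι {R M : Type*} [CommRing R] [AddCommGroup M] [Module R M]
    {Q : QuadraticForm R M} (v : M) (a : CliffordAlgebra Q) :
    ι Q v * a - involute a * ι Q v = contractLeft (QuadraticMap.polarBilin Q v) a := by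
  induction a using CliffordAlgebra.left_induction with
  | algebraMap r => rw [AlgHom.commutes, contractLeft_algebraMap, Algebra.commutes, sub_self]
  | add x y hx hy => rw [map_add, map_add, ← hx, ← hy]; noncomm_ring
  | ι_mul x w hx =>
    rw [contractLeft_ι_mul, ← hx, map_mul, involute_ι, QuadraticMap.polarBilin_apply_apply,
      Algebra.smul_def, ← ι_mul_ι_add_swap]
    noncomm_ring

theorem mem_range_of_twisted_commute {K M : Type*} [Field K] [CharZero K]
    [AddCommGroup M] [Module K M] [FiniteDimensional K M] {Q : QuadraticForm K M}
    (hQ : (QuadraticMap.polarBilin Q).Nondegenerate) {a : CliffordAlgebra Q}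
    (h : ∀ v : M, ι Q v * a = involute a * ι Q v) :
    ∃ r : K, a = algebraMap K _ r := by
  refine mem_range_of_contractLeft_eq_zero fun d => ?_
  obtain ⟨v, rfl⟩ := (LinearMap.BilinForm.toDual (QuadraticMap.polarBilin Q) hQ).surjective d
  have : LinearMap.BilinForm.toDual (QuadraticMap.polarBilin Q) hQ v =
      QuadraticMap.polarBilin Q v := rfl
  rw [this, ← ι_mul_sub_involute_mul_ι, h, sub_self]

theorem ι_injective {K M : Type*} [Field K] [CharZero K]
    [AddCommGroup M] [Module K M] (Q : QuadraticForm K M) : Function.Injective (ι Q) := by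
  let _ : Invertible (2 : K) := invertibleOfNonzero two_ne_zero
  intro x y hxy
  have h : equivExterior Q (ι Q x) = equivExterior Q (ι Q y) := by rw [hxy]
  have e (z : M) : equivExterior Q (ι Q z) = ExteriorAlgebra.ι K z :=
    changeForm_ι changeForm.associated_neg_proof z
  rw [e, e] at h
  exact (ExteriorAlgebra.ι_inj K x y).mp h

instance finiteDimensional {K M : Type*} [Field K] [CharZero K]
    [AddCommGroup M] [Module K M] [FiniteDimensional K M] (Q : QuadraticForm K M) :
    FiniteDimensional K (CliffordAlgebra Q) := by
  let _ : Invertible (2 : K) := invertibleOfNonzero two_ne_zero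
  have := Module.Finite.of_basis (Module.Basis.ExteriorAlgebra (Module.finBasis K M))
  exact Module.Finite.equiv (equivExterior Q).symm

end CliffordAlgebra

/-! ### Lipschitz elements: isometry, norm and parity. -/

section Lipschitz

variable {V : Type*} [AddCommGroup V] [Module ℝ V] {Q : QuadraticForm ℝ V}

theorem Cl.algebraMap_injective (Q : QuadraticForm ℝ V) :
    Function.Injective (algebraMap ℝ (Cl Q)) :=
  (algebraMap ℝ (Cl Q)).injective

/-- The linear action `x ↦ g x ĝ⁻¹` of an element of the Lipschitz group. -/
theorem LipschitzSet.exists_action {g : (Cl Q)ˣ} (hg : g ∈ LipschitzSet Q) :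
    ∃ L : V →ₗ[ℝ] V, ∀ x, (g : Cl Q) * Cl.vec Q x = Cl.vec Q (L x) * Cl.grade Q g := by
  choose f hf using hg
  have h (x : V) : (g : Cl Q) * Cl.vec Q x = Cl.vec Q (f x) * Cl.grade Q g := by
    rw [← hf x, mul_assoc]
    have : (((Units.map (Cl.grade Q : Cl Q →* Cl Q) g)⁻¹ : (Cl Q)ˣ) : Cl Q) * Cl.grade Q g = 1 :=
      Units.inv_mul (Units.map (Cl.grade Q : Cl Q →* Cl Q) g)
    rw [this, mul_one]
  refine ⟨⟨⟨f, fun x y => CliffordAlgebra.ι_injective (-Q) ?_⟩,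
    fun r x => CliffordAlgebra.ι_injective (-Q) ?_⟩, h⟩
  · rw [map_add, ← hf, ← hf, ← hf, map_add, mul_add, add_mul]
  · rw [RingHom.id_apply, map_smul, ← hf, ← hf, map_smul, mul_smul_comm, smul_mul_assoc]

variable {g : (Cl Q)ˣ} {L : V →ₗ[ℝ] V}
  (hL : ∀ x, (g : Cl Q) * Cl.vec Q x = Cl.vec Q (L x) * Cl.grade Q g)

include hL

theorem lipschitz_grade_mul_vec (x : V) :
    Cl.grade Q (g : Cl Q) * Cl.vec Q x = Cl.vec Q (L x) * g := by
  have := congrArg (Cl.grade Q) (hL x)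
  rw [map_mul, map_mul, CliffordAlgebra.involute_involute, CliffordAlgebra.involute_ι,
    CliffordAlgebra.involute_ι, mul_neg, neg_mul] at this
  exact neg_injective this

theorem lipschitz_isometry (x : V) : Q (L x) = Q x := by
  have h : algebraMap ℝ (Cl Q) (-Q (L x)) * g = algebraMap ℝ (Cl Q) (-Q x) * g := by
    have e (v : V) : algebraMap ℝ (Cl Q) (-Q v) = Cl.vec Q v * Cl.vec Q v :=
      (CliffordAlgebra.ι_sq_scalar (-Q) v).symm
    rw [Algebra.commutes (-Q x), e, e, mul_assoc, ← lipschitz_grade_mul_vec hL, ← mul_assoc,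
      ← mul_assoc, hL]
  exact neg_injective (Cl.algebraMap_injective Q (g.isUnit.mul_right_cancel h))

variable [FiniteDimensional ℝ V] (hQ : (QuadraticMap.polarBilin (-Q)).Nondegenerate)

include hQ

theorem lipschitz_norm : ∃ N : ℝ, N ≠ 0 ∧
    (g : Cl Q) * Cl.rev Q (Cl.grade Q g) = algebraMap ℝ (Cl Q) N := by
  obtain ⟨N, hN⟩ := CliffordAlgebra.mem_range_of_twisted_commute hQ
    -- Moving `v` past `g` produces `L v`, and the reversed relation turns it back into `v`.
    (a := Cl.rev Q (Cl.grade Q g) * g) fun v => by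
    have h1 := congrArg (Cl.rev Q) (lipschitz_grade_mul_vec hL v)
    rw [CliffordAlgebra.reverse.map_mul, CliffordAlgebra.reverse.map_mul,
      CliffordAlgebra.reverse_ι, CliffordAlgebra.reverse_ι] at h1
    rw [map_mul, ← CliffordAlgebra.reverse_involute, CliffordAlgebra.involute_involute,
      ← mul_assoc, h1, mul_assoc, mul_assoc, ← lipschitz_grade_mul_vec hL]
  have hu : IsUnit (Cl.rev Q (Cl.grade Q (g : Cl Q))) := by
    have h := (g.isUnit.map (Cl.grade Q)).map (CliffordAlgebra.reverseOp (Q := -Q))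
    exact h.unop
  refine ⟨N, ?_, ?_⟩
  · rintro rfl
    rw [map_zero] at hN
    exact (hu.mul g.isUnit).ne_zero hN
  · apply g.isUnit.mul_right_cancel
    rw [mul_assoc, hN, Algebra.commutes]

theorem lipschitz_grade_eq : ∃ ε : ℝ, ε ^ 2 = 1 ∧
    Cl.grade Q (g : Cl Q) = algebraMap ℝ (Cl Q) ε * g := by
  -- The element is `1 + g⁻¹ĝ`, so the parity sign is `ε = k - 1`; its square is `1` because the
  -- grade involution is an involution.
  obtain ⟨k, hk⟩ := CliffordAlgebra.mem_range_of_twisted_commute hQ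
    (a := (↑g⁻¹ : Cl Q) * (g + Cl.grade Q g)) fun v => by
    apply (g.isUnit.map (Cl.grade Q)).mul_left_cancel
    rw [map_mul, ← mul_assoc, ← mul_assoc, ← mul_assoc, ← mul_assoc, ← map_mul,
      Units.mul_inv, map_one, one_mul, lipschitz_grade_mul_vec hL, mul_assoc (Cl.vec Q (L v)),
      Units.mul_inv, mul_one, map_add, CliffordAlgebra.involute_involute, mul_add, add_mul,
      lipschitz_grade_mul_vec hL, hL, add_comm]
  have h1 : Cl.grade Q (g : Cl Q) = algebraMap ℝ (Cl Q) (k - 1) * g := by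
    have := congrArg ((g : Cl Q) * ·) hk
    simp only [Units.mul_inv_cancel_left] at this
    rw [map_sub, map_one, sub_mul, Algebra.commutes, ← this, one_mul, add_sub_cancel_left]
  refine ⟨k - 1, Cl.algebraMap_injective Q (g.isUnit.mul_right_cancel ?_), h1⟩
  have h2 := congrArg (Cl.grade Q) h1
  rw [CliffordAlgebra.involute_involute, map_mul, AlgHom.commutes, h1, ← mul_assoc, ← map_mul,
    ← pow_two] at h2
  rw [map_one, one_mul, ← h2]

end Lipschitz

theorem polarBilin_neg_hatQ_nondegenerate {V : Type*} [AddCommGroup V] [Module ℝ V]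
    {Q : QuadraticForm ℝ V} (hQ : (formB Q).Nondegenerate) :
    (QuadraticMap.polarBilin (-hatQ Q)).Nondegenerate := by
  have key (w : V × ℝ × ℝ) (h : ∀ z, QuadraticMap.polar (-hatQ Q) w z = 0) : w = 0 := by
    have e (z : V × ℝ × ℝ) : QuadraticMap.polar (-hatQ Q) w z =
        -(2 * formB Q w.1 z.1) + 2 * (w.2.1 * z.2.1) - 2 * (w.2.2 * z.2.2) := by
      have hB : 2 * formB Q w.1 z.1 = Q (w.1 + z.1) - Q w.1 - Q z.1 := by
        simp [formB, QuadraticMap.associated_apply]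
      simp only [QuadraticMap.polar, neg_apply, hatQ_apply, hB, Prod.fst_add,
        Prod.snd_add]
      ring
    have h1 : w.1 = 0 := hQ.1 _ fun v => by
      have := h (v, 0, 0)
      rw [e] at this
      simpa using this
    have h2 : w.2.1 = 0 := by
      have := h (0, 1, 0)
      rw [e] at this
      simpa using this
    have h3 : w.2.2 = 0 := by
      have := h (0, 0, 1)
      rw [e] at this
      simpa using this
    exact Prod.ext h1 (Prod.ext h2 h3)
  exact ⟨key, fun w h => key w fun z => by rw [QuadraticMap.polar_comm]; exact h z⟩

/-! ### Involutions and null vectors in matrix form. -/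

section Matrices

variable {V : Type*} [AddCommGroup V] [Module ℝ V] (Q : QuadraticForm ℝ V)

theorem jHat_vec (w : V × ℝ × ℝ) : jHat Q (Cl.vec (hatQ Q) w) = jVec Q w :=
  CliffordAlgebra.lift_ι_apply _ _ _

theorem jVec_eq (w : V × ℝ × ℝ) :
    jVec Q w = !![Cl.vec Q w.1, algebraMap ℝ (Cl Q) (w.2.1 - w.2.2);
                algebraMap ℝ (Cl Q) (w.2.1 + w.2.2), -Cl.vec Q w.1] := rfl

theorem jHat_grade (g : Cl (hatQ Q)) :
    jHat Q (Cl.grade (hatQ Q) g) =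
      !![Cl.grade Q (jHat Q g 0 0), -Cl.grade Q (jHat Q g 0 1);
        -Cl.grade Q (jHat Q g 1 0), Cl.grade Q (jHat Q g 1 1)] := by
  induction g using CliffordAlgebra.induction with
  | algebraMap r =>
    ext i k
    fin_cases i <;> fin_cases k <;> simp [Matrix.algebraMap_matrix_apply]
  | ι w =>
    rw [CliffordAlgebra.involute_ι, map_neg, jHat_vec, jVec_eq]
    ext i k
    fin_cases i <;> fin_cases k <;> simp
  | mul a b ha hb =>
    rw [map_mul, map_mul, ha, hb, map_mul]
    generalize jHat Q a = A, jHat Q b = B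
    rw [Matrix.mul_fin_two]
    simp only [Matrix.mul_apply, Fin.sum_univ_two, map_add, map_mul, neg_mul, mul_neg, neg_neg,
      neg_add]
  | add a b ha hb =>
    rw [map_add, map_add, ha, hb, map_add]
    ext i k
    fin_cases i <;> fin_cases k <;> simp [-neg_add_rev, neg_add]

/-- Both sides are anti-multiplicative in `g`, so it suffices to compare them on scalars and
vectors. -/
theorem jHat_rev (g : Cl (hatQ Q)) :
    jHat Q (Cl.rev (hatQ Q) g) =
      !![Cl.rev Q (Cl.grade Q (jHat Q g 1 1)), Cl.rev Q (Cl.grade Q (jHat Q g 0 1));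
        Cl.rev Q (Cl.grade Q (jHat Q g 1 0)), Cl.rev Q (Cl.grade Q (jHat Q g 0 0))] := by
  induction g using CliffordAlgebra.induction with
  | algebraMap r =>
    ext i k
    fin_cases i <;> fin_cases k <;> simp [Matrix.algebraMap_matrix_apply]
  | ι w =>
    rw [CliffordAlgebra.reverse_ι, jHat_vec, jVec_eq]
    ext i k
    fin_cases i <;> fin_cases k <;> simp
  | mul a b ha hb =>
    rw [CliffordAlgebra.reverse.map_mul, map_mul, ha, hb, map_mul]
    generalize jHat Q a = A, jHat Q b = B
    rw [Matrix.mul_fin_two]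
    ext i k
    fin_cases i <;> fin_cases k <;>
      simp only [Matrix.mul_apply, Fin.sum_univ_two, map_add, map_mul, Matrix.of_apply,
        Matrix.cons_val_zero, Matrix.cons_val_one, Matrix.cons_val_fin_one, Matrix.cons_val',
        Fin.zero_eta, Fin.mk_one, CliffordAlgebra.reverse.map_mul] <;>
      exact add_comm _ _
  | add a b ha hb =>
    rw [map_add, map_add, ha, hb, map_add]
    ext i k
    fin_cases i <;> fin_cases k <;> simp

/-- The null vector of `V ⊕ ℝ^{1,1}` that represents the point `x` of `V`. -/
noncomputable def nullLift {V : Type*} [AddCommGroup V] [Module ℝ V] (Q : QuadraticForm ℝ V) (x : V) :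
    V × ℝ × ℝ :=
  (x, (Q x + 1) / 2, (1 - Q x) / 2)

theorem hatQ_nullLift (x : V) : hatQ Q (nullLift Q x) = 0 := by
  rw [hatQ_apply, nullLift]
  ring

/-- The normalisation makes the `ℝ^{1,1}`-part of the difference null. -/
theorem hatQ_nullLift_sub (x y : V) :
    hatQ Q (nullLift Q x - nullLift Q y) = Q (x - y) := by
  simp only [hatQ_apply, nullLift, Prod.fst_sub, Prod.snd_sub]
  ring

theorem jVec_nullLift (x : V) :
    jVec Q (nullLift Q x) = !![Cl.vec Q x, algebraMap ℝ (Cl Q) (Q x); 1, -Cl.vec Q x] := by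
  rw [jVec_eq]
  have h1 : (Q x + 1) / 2 - (1 - Q x) / 2 = Q x := by ring
  have h2 : (Q x + 1) / 2 + (1 - Q x) / 2 = 1 := by ring
  simp only [nullLift, h1, h2, map_one]

theorem grade_moebiusDen {g : Cl (hatQ Q)} {ε : ℝ}
    (hε : Cl.grade (hatQ Q) g = algebraMap ℝ _ ε * g) (x : V) :
    Cl.grade Q (moebiusDen Q (jHat Q g) x) = algebraMap ℝ _ ε * moebiusDen Q (jHat Q g) x := by
  have h := jHat_grade Q g
  rw [hε, map_mul, AlgHom.commutes, ← Algebra.smul_def] at h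
  have h10 := congrFun (congrFun h 1) 0
  have h11 := congrFun (congrFun h 1) 1
  simp only [Matrix.smul_apply, Matrix.of_apply, Matrix.cons_val_zero, Matrix.cons_val_one,
    Matrix.cons_val_fin_one, Matrix.cons_val'] at h10 h11
  rw [moebiusDen, map_add, map_mul, CliffordAlgebra.involute_ι, ← h11, mul_neg, ← neg_mul, ← h10,
    ← Algebra.smul_def, smul_add, smul_mul_assoc]

theorem rev_moebiusDen (A : Matrix (Fin 2) (Fin 2) (Cl Q)) (x : V) :
    Cl.rev Q (moebiusDen Q A x) = Cl.vec Q x * Cl.rev Q (A 1 0) + Cl.rev Q (A 1 1) := by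
  rw [moebiusDen, map_add, CliffordAlgebra.reverse.map_mul, CliffordAlgebra.reverse_ι]

theorem pseudoDet_jHat {g : Cl (hatQ Q)} {N : ℝ}
    (hN : g * Cl.rev (hatQ Q) (Cl.grade (hatQ Q) g) = algebraMap ℝ _ N) :
    pseudoDet Q (jHat Q g) = algebraMap ℝ _ N := by
  have h := congrFun (congrFun (congrArg (jHat Q) hN) 0) 0
  rw [map_mul, jHat_rev, jHat_grade, AlgHom.commutes] at h
  simp [Matrix.mul_apply, Matrix.algebraMap_matrix_apply] at h
  rw [pseudoDet, sub_eq_add_neg, h]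

theorem moebius_mul_conj {g : Cl (hatQ Q)} {N : ℝ}
    (hN : g * Cl.rev (hatQ Q) (Cl.grade (hatQ Q) g) = algebraMap ℝ _ N) {x : V}
    {w : V × ℝ × ℝ} (hw : g * Cl.vec (hatQ Q) (nullLift Q x) =
      Cl.vec (hatQ Q) w * Cl.grade (hatQ Q) g) :
    moebiusNum Q (jHat Q g) x * Cl.rev Q (Cl.grade Q (moebiusDen Q (jHat Q g) x)) =
        algebraMap ℝ _ N * Cl.vec Q w.1 ∧
      moebiusDen Q (jHat Q g) x * Cl.rev Q (Cl.grade Q (moebiusDen Q (jHat Q g) x)) =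
        algebraMap ℝ _ (N * (w.2.1 + w.2.2)) := by
  have hN' : Cl.grade (hatQ Q) g * Cl.rev (hatQ Q) g = algebraMap ℝ _ N := by
    have := congrArg (Cl.grade (hatQ Q)) hN
    rwa [map_mul, ← CliffordAlgebra.reverse_involute, CliffordAlgebra.involute_involute,
      AlgHom.commutes] at this
  have h : g * Cl.vec (hatQ Q) (nullLift Q x) * Cl.rev (hatQ Q) g =
      algebraMap ℝ _ N * Cl.vec (hatQ Q) w := by
    rw [hw, mul_assoc, hN', Algebra.commutes]
  have h' := congrArg (jHat Q) h
  rw [map_mul, map_mul, map_mul, jHat_vec, jHat_vec, jHat_rev, jVec_nullLift, AlgHom.commutes,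
    jVec_eq, ← Algebra.smul_def] at h'
  have h00 := congrFun (congrFun h' 0) 0
  have h10 := congrFun (congrFun h' 1) 0
  -- This exposes the rank-one factorisation of the lift's matrix.
  have hx : algebraMap ℝ (Cl Q) (Q x) = -(Cl.vec Q x * Cl.vec Q x) := by
    rw [CliffordAlgebra.ι_sq_scalar, neg_apply, map_neg, neg_neg]
  simp only [Matrix.mul_apply, Fin.sum_univ_two, Matrix.smul_apply, Matrix.of_apply,
    Matrix.cons_val_zero, Matrix.cons_val_one, Matrix.cons_val_fin_one, Matrix.cons_val', hx,
    Algebra.smul_def, ← map_mul, mul_one] at h00 h10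
  have hc : Cl.rev Q (Cl.grade Q (moebiusDen Q (jHat Q g) x)) =
      Cl.rev Q (Cl.grade Q (jHat Q g 1 1)) -
        Cl.vec Q x * Cl.rev Q (Cl.grade Q (jHat Q g 1 0)) := by
    rw [moebiusDen, map_add, map_add, map_mul, CliffordAlgebra.reverse.map_mul,
      CliffordAlgebra.involute_ι, map_neg, CliffordAlgebra.reverse_ι]
    noncomm_ring
  rw [hc, ← h00, ← h10, moebiusNum, moebiusDen]
  constructor <;> noncomm_ring

end Matrices

/-- A Vahlen matrix acts on the null vectors of `V ⊕ ℝ^{1,1}` by a linear isometry that computes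
the numerator and the denominator of the Möbius map. -/
theorem IsVahlen.exists_isometry {V : Type*} [AddCommGroup V] [Module ℝ V]
    [FiniteDimensional ℝ V] {Q : QuadraticForm ℝ V} (hQ : (formB Q).Nondegenerate)
    {A : Matrix (Fin 2) (Fin 2) (Cl Q)} (hA : IsVahlen Q A) :
    ∃ (L : V × ℝ × ℝ →ₗ[ℝ] V × ℝ × ℝ) (ε N : ℝ), ε ^ 2 = 1 ∧ N ≠ 0 ∧
      (∀ w, hatQ Q (L w) = hatQ Q w) ∧ pseudoDet Q A = algebraMap ℝ (Cl Q) N ∧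
      ∀ x, moebiusNum Q A x * Cl.rev Q (moebiusDen Q A x) =
          algebraMap ℝ (Cl Q) (ε * N) * Cl.vec Q (L (nullLift Q x)).1 ∧
        moebiusDen Q A x * Cl.rev Q (moebiusDen Q A x) = algebraMap ℝ (Cl Q)
          (ε * N * ((L (nullLift Q x)).2.1 + (L (nullLift Q x)).2.2)) := by
  obtain ⟨g, hg, rfl⟩ := hA
  obtain ⟨L, hL⟩ := LipschitzSet.exists_action hg
  have hn := polarBilin_neg_hatQ_nondegenerate hQ
  obtain ⟨N, hN0, hN⟩ := lipschitz_norm hL hn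
  obtain ⟨ε, hε, hg'⟩ := lipschitz_grade_eq hL hn
  refine ⟨L, ε, N, hε, hN0, lipschitz_isometry hL, pseudoDet_jHat Q hN, fun x => ?_⟩
  obtain ⟨h1, h2⟩ := moebius_mul_conj Q hN (hL (nullLift Q x))
  rw [grade_moebiusDen Q hg', ← Algebra.smul_def, map_smul, mul_smul_comm] at h1 h2
  have hs (z z' : Cl Q) (h : ε • z = z') : z = ε • z' := by
    rw [← h, smul_smul, ← pow_two, hε, one_smul]
  rw [hs _ _ h1, hs _ _ h2, Algebra.smul_def, Algebra.smul_def, mul_assoc ε, map_mul _ ε,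
    map_mul _ ε, mul_assoc]
  exact ⟨rfl, rfl⟩

/-! ### From a two-point identity to the derivative. -/

theorem QuadraticForm.contDiff {V : Type*} [NormedAddCommGroup V] [NormedSpace ℝ V]
    [FiniteDimensional ℝ V] (Q : QuadraticForm ℝ V) {n : WithTop ℕ∞} :
    ContDiff ℝ n (fun x => Q x) := by
  have h (x : V) : Q x = LinearMap.toContinuousLinearMap
      ((LinearMap.toContinuousLinearMap (𝕜 := ℝ) (E := V) (F' := ℝ)).toLinearMap ∘ₗ
        QuadraticMap.associated Q) x x := (QuadraticMap.associated_eq_self_apply ℝ Q x).symm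
  simp_rw [h]
  exact (ContinuousLinearMap.contDiff _).clm_apply contDiff_id

theorem formB_apply {V : Type*} [AddCommGroup V] [Module ℝ V] (Q : QuadraticForm ℝ V) (u v : V) :
    formB Q u v = (Q (u + v) - Q u - Q v) / 2 := by
  simp [formB, QuadraticMap.associated_apply]
  ring

/-- Put `y = x + t u`, divide by `t²` and let `t → 0`: the difference quotient tends to the
derivative, and `k y` to `k x`. -/
theorem QuadraticForm.apply_fderiv_of_apply_sub {V : Type*} [NormedAddCommGroup V]
    [NormedSpace ℝ V] [FiniteDimensional ℝ V] (Q : QuadraticForm ℝ V) {U : Set V} (hU : IsOpen U)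
    {φ : V → V} {k : V → ℝ} {x : V} (hx : x ∈ U) (hφ : DifferentiableAt ℝ φ x)
    (hk : ContinuousAt k x)
    (h : ∀ y ∈ U, Q (φ y - φ x) = k x * k y * Q (y - x)) (u : V) :
    Q (fderiv ℝ φ x u) = k x ^ 2 * Q u := by
  have hline : HasDerivAt (fun t : ℝ => φ (x + t • u)) (fderiv ℝ φ x u) 0 := by
    have hl : HasDerivAt (fun t : ℝ => x + t • u) u 0 := by
      simpa using ((hasDerivAt_id (0 : ℝ)).smul_const u).const_add x
    have hf : HasFDerivAt φ (fderiv ℝ φ x) (x + (0 : ℝ) • u) := by simpa using hφ.hasFDerivAt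
    exact hf.comp_hasDerivAt (0 : ℝ) hl
  have hcont : ContinuousAt (fun t : ℝ => x + t • u) 0 := by fun_prop
  have h0 : x + (0 : ℝ) • u = x := by simp
  rw [hasDerivAt_iff_tendsto_slope_zero] at hline
  have h1 := (Q.contDiff (n := 0)).continuous.continuousAt.tendsto.comp hline
  have hk' : ContinuousAt (fun t : ℝ => k (x + t • u)) 0 :=
    ContinuousAt.comp (by rwa [h0]) hcont
  have h2 : Filter.Tendsto (fun t : ℝ => k x * k (x + t • u) * Q u) (nhdsWithin 0 {0}ᶜ)
      (nhds (k x ^ 2 * Q u)) := by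
    have := (hk'.const_mul (k x)).mul_const (Q u) |>.tendsto.mono_left
      (nhdsWithin_le_nhds (s := {0}ᶜ))
    simpa [pow_two] using this
  refine tendsto_nhds_unique h1 (h2.congr' ?_)
  have hmem : ∀ᶠ t : ℝ in nhdsWithin 0 {0}ᶜ, x + t • u ∈ U :=
    (hcont.eventually_mem (by rw [h0]; exact hU.mem_nhds hx)).filter_mono nhdsWithin_le_nhds
  filter_upwards [hmem, self_mem_nhdsWithin] with t ht ht0
  have ht0' : t ≠ 0 := ht0
  simp only [Function.comp_apply, zero_add, zero_smul, add_zero]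
  rw [QuadraticMap.map_smul, h _ ht, add_sub_cancel_left, QuadraticMap.map_smul, smul_eq_mul,
    smul_eq_mul]
  field_simp

/-! ### The Möbius map and its factor in terms of null vectors. -/

section Moebius

variable {V : Type*} [AddCommGroup V] [Module ℝ V] {Q : QuadraticForm ℝ V}

/-- Two null vectors of `V ⊕ ℝ^{1,1}` seen as points of `V`. -/
theorem apply_sub_of_hatQ_eq_zero {w z : V × ℝ × ℝ} (hw : hatQ Q w = 0) (hz : hatQ Q z = 0)
    (hw0 : w.2.1 + w.2.2 ≠ 0) (hz0 : z.2.1 + z.2.2 ≠ 0) :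
    Q ((w.2.1 + w.2.2)⁻¹ • w.1 - (z.2.1 + z.2.2)⁻¹ • z.1) =
      (z.2.1 + z.2.2)⁻¹ * (w.2.1 + w.2.2)⁻¹ * hatQ Q (w - z) := by
  have e (r s : ℝ) (u v : V) :
      Q (r • u - s • v) = r ^ 2 * Q u + s ^ 2 * Q v - r * s * QuadraticMap.polar Q u v := by
    rw [sub_eq_add_neg, ← neg_smul, QuadraticMap.map_add Q, QuadraticMap.map_smul,
      QuadraticMap.map_smul, QuadraticMap.polar_smul_left, QuadraticMap.polar_smul_right]
    simp only [smul_eq_mul]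
    ring
  have e1 : Q (w.1 - z.1) = Q w.1 + Q z.1 - QuadraticMap.polar Q w.1 z.1 := by
    simpa using e 1 1 w.1 z.1
  rw [hatQ_apply] at hw hz
  -- Nullness eliminates the squares, leaving only the pairing of `w` and `z`, from which the
  -- scalings factor out.
  have hw' : Q w.1 = (w.2.1 - w.2.2) * (w.2.1 + w.2.2) := by linear_combination hw
  have hz' : Q z.1 = (z.2.1 - z.2.2) * (z.2.1 + z.2.2) := by linear_combination hz
  rw [e, hatQ_apply, Prod.fst_sub, Prod.snd_sub, Prod.fst_sub, Prod.snd_sub, e1, hw', hz']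
  field_simp
  ring

variable {A : Matrix (Fin 2) (Fin 2) (Cl Q)} {x y : V} {k t : ℝ}

theorem mem_moebiusDomain_iff [FiniteDimensional ℝ V] (hk : k ≠ 0)
    (hd : moebiusDen Q A x * Cl.rev Q (moebiusDen Q A x) = algebraMap ℝ (Cl Q) (k * t)) :
    x ∈ moebiusDomain Q A ↔ t ≠ 0 := by
  -- Finite dimension makes the one-sided inverse found below two-sided.
  have := IsArtinianRing.of_finite ℝ (Cl Q)
  constructor
  · rintro (hx : IsUnit _) rfl
    have hu : IsUnit (Cl.rev Q (moebiusDen Q A x)) :=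
      (hx.map (CliffordAlgebra.reverseOp (Q := -Q))).unop
    rw [mul_zero, map_zero] at hd
    exact (hx.mul hu).ne_zero hd
  · intro ht
    refine IsUnit.of_mul_eq_one (Cl.rev Q (moebiusDen Q A x) * algebraMap ℝ _ (k * t)⁻¹) ?_
    rw [← mul_assoc, hd, ← map_mul, mul_inv_cancel₀ (mul_ne_zero hk ht), map_one]

theorem inverse_moebiusDen (hx : x ∈ moebiusDomain Q A) (hk : k ≠ 0) (ht : t ≠ 0)
    (hd : moebiusDen Q A x * Cl.rev Q (moebiusDen Q A x) = algebraMap ℝ (Cl Q) (k * t)) :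
    Ring.inverse (moebiusDen Q A x) = Cl.rev Q (moebiusDen Q A x) * algebraMap ℝ _ (k * t)⁻¹ := by
  apply IsUnit.mul_left_cancel hx
  rw [Ring.mul_inverse_cancel _ hx, ← mul_assoc, hd, ← map_mul,
    mul_inv_cancel₀ (mul_ne_zero hk ht), map_one]

/-- The hypothesis has the factors in the other order; they may be swapped because the product is a
nonzero scalar and the inverse is two-sided. -/
theorem conformalDen_eq (hx : x ∈ moebiusDomain Q A) (hk : k ≠ 0) (ht : t ≠ 0)
    (hd : moebiusDen Q A x * Cl.rev Q (moebiusDen Q A x) = algebraMap ℝ (Cl Q) (k * t)) :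
    conformalDen Q A x = algebraMap ℝ _ (k * t) := by
  have h := Ring.inverse_mul_cancel _ hx
  rw [inverse_moebiusDen hx hk ht hd, mul_assoc, Algebra.commutes, ← mul_assoc] at h
  have h' := congrArg (· * algebraMap ℝ (Cl Q) (k * t)) h
  simp only [mul_assoc, ← map_mul, inv_mul_cancel₀ (mul_ne_zero hk ht), map_one, mul_one,
    one_mul] at h'
  rw [← h', rev_moebiusDen]
  rfl

theorem moebiusNum_mul_inverse (hx : x ∈ moebiusDomain Q A) (hk : k ≠ 0) (ht : t ≠ 0)
    (hd : moebiusDen Q A x * Cl.rev Q (moebiusDen Q A x) = algebraMap ℝ (Cl Q) (k * t))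
    (hn : moebiusNum Q A x * Cl.rev Q (moebiusDen Q A x) =
      algebraMap ℝ (Cl Q) k * Cl.vec Q y) :
    moebiusNum Q A x * Ring.inverse (moebiusDen Q A x) = Cl.vec Q (t⁻¹ • y) := by
  rw [inverse_moebiusDen hx hk ht hd, ← mul_assoc, hn, ← Algebra.commutes, ← mul_assoc, ← map_mul,
    map_smul, Algebra.smul_def, mul_inv, mul_right_comm, inv_mul_cancel₀ hk, one_mul]

theorem moebiusMap_eq
    (h : moebiusNum Q A x * Ring.inverse (moebiusDen Q A x) = Cl.vec Q y) :
    moebiusMap Q A x = y := by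
  rw [moebiusMap, h]
  exact Function.leftInverse_invFun (CliffordAlgebra.ι_injective (-Q)) y

theorem conformalFactor_eq {δ r : ℝ} (hr : r ≠ 0) (hδ : pseudoDet Q A = algebraMap ℝ (Cl Q) δ)
    (h : conformalDen Q A x = algebraMap ℝ (Cl Q) r) : conformalFactor Q A x = δ / r := by
  have hi : Ring.inverse (algebraMap ℝ (Cl Q) r) = algebraMap ℝ (Cl Q) r⁻¹ := by
    have hu : IsUnit (algebraMap ℝ (Cl Q) r) := (IsUnit.mk0 r hr).map _
    apply hu.mul_left_cancel
    rw [Ring.mul_inverse_cancel _ hu, ← map_mul, mul_inv_cancel₀ hr, map_one]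
  rw [conformalFactor, hδ, h, hi, ← map_mul, div_eq_mul_inv]
  exact Function.leftInverse_invFun (Cl.algebraMap_injective Q) _

end Moebius

/-! ### Assembly of the theorem. -/

theorem mainTheorem7 {V : Type*} [NormedAddCommGroup V] [NormedSpace ℝ V]
    [FiniteDimensional ℝ V] (Q : QuadraticForm ℝ V) (hQ : (formB Q).Nondegenerate)
    (A : Matrix (Fin 2) (Fin 2) (Cl Q)) (hA : IsVahlen Q A) :
    -- the Möbius map is a well-defined smooth `V`-valued map on the open set where it makes sense
    IsOpen (moebiusDomain Q A) ∧
    (∀ x ∈ moebiusDomain Q A, Cl.vec Q (moebiusMap Q A x)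
      = moebiusNum Q A x * Ring.inverse (moebiusDen Q A x)) ∧
    ContDiffOn ℝ ∞ (moebiusMap Q A) (moebiusDomain Q A) ∧
    -- `Ω_A` is a quotient of nonzero real numbers, and is smooth
    (∃ δ : ℝ, δ ≠ 0 ∧ pseudoDet Q A = algebraMap ℝ (Cl Q) δ ∧
      ∀ x ∈ moebiusDomain Q A, ∃ r : ℝ, r ≠ 0 ∧
        conformalDen Q A x = algebraMap ℝ (Cl Q) r ∧ conformalFactor Q A x = δ / r) ∧
    ContDiffOn ℝ ∞ (conformalFactor Q A) (moebiusDomain Q A) ∧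
    -- the pull-back formula
    (∀ x ∈ moebiusDomain Q A,
      pullbackB Q (moebiusMap Q A) x = conformalFactor Q A x ^ 2 • formB Q) ∧
    -- conformality
    (∀ U : Set V, U ⊆ moebiusDomain Q A → IsOpen U → IsConnected U →
      IsConformalTransformation Q U (moebiusMap Q A)) := by
  obtain ⟨L, ε, N, hε, hN, hiso, hdet, hL⟩ := hA.exists_isometry hQ
  have hε0 : ε ≠ 0 := by
    rintro rfl
    norm_num at hε
  have hk : ε * N ≠ 0 := mul_ne_zero hε0 hN
  let w (x : V) : V × ℝ × ℝ := L (nullLift Q x)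
  let τ (x : V) : ℝ := (w x).2.1 + (w x).2.2
  have hdom (x : V) : x ∈ moebiusDomain Q A ↔ τ x ≠ 0 := mem_moebiusDomain_iff hk (hL x).2
  have hws : ContDiff ℝ ∞ w := by
    have hlift : ContDiff ℝ ∞ (nullLift Q) := by
      have := Q.contDiff (n := ∞)
      unfold nullLift
      fun_prop
    exact (LinearMap.toContinuousLinearMap L).contDiff.comp hlift
  have hτs : ContDiff ℝ ∞ τ := hws.snd.fst.add hws.snd.snd
  have hopen : IsOpen (moebiusDomain Q A) := by
    have : moebiusDomain Q A = τ ⁻¹' {0}ᶜ := Set.ext hdom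
    rw [this]
    exact isOpen_compl_singleton.preimage hτs.continuous
  have hquot (x) (hx : x ∈ moebiusDomain Q A) :
      moebiusNum Q A x * Ring.inverse (moebiusDen Q A x) = Cl.vec Q ((τ x)⁻¹ • (w x).1) :=
    moebiusNum_mul_inverse hx hk ((hdom x).mp hx) (hL x).2 (hL x).1
  have hmap (x) (hx : x ∈ moebiusDomain Q A) : moebiusMap Q A x = (τ x)⁻¹ • (w x).1 :=
    moebiusMap_eq (hquot x hx)
  have hden (x) (hx : x ∈ moebiusDomain Q A) :
      conformalDen Q A x = algebraMap ℝ _ (ε * N * τ x) :=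
    conformalDen_eq hx hk ((hdom x).mp hx) (hL x).2
  have hfac (x) (hx : x ∈ moebiusDomain Q A) :
      conformalFactor Q A x = N / (ε * N * τ x) :=
    conformalFactor_eq (mul_ne_zero hk ((hdom x).mp hx)) hdet (hden x hx)
  have hτinv : ContDiffOn ℝ ∞ (fun x => (τ x)⁻¹) (moebiusDomain Q A) :=
    hτs.contDiffOn.inv fun x hx => (hdom x).mp hx
  have hsm : ContDiffOn ℝ ∞ (moebiusMap Q A) (moebiusDomain Q A) :=
    (hτinv.smul hws.fst.contDiffOn).congr hmap
  have hfs : ContDiffOn ℝ ∞ (conformalFactor Q A) (moebiusDomain Q A) := by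
    refine ContDiffOn.congr (f := fun x => N / (ε * N * τ x)) ?_ hfac
    exact contDiffOn_const.div (contDiffOn_const.mul hτs.contDiffOn)
      fun x hx => mul_ne_zero hk ((hdom x).mp hx)
  have hfac0 (x) (hx : x ∈ moebiusDomain Q A) : conformalFactor Q A x ≠ 0 := by
    rw [hfac x hx]
    exact div_ne_zero hN (mul_ne_zero hk ((hdom x).mp hx))
  have hpull (x) (hx : x ∈ moebiusDomain Q A) :
      pullbackB Q (moebiusMap Q A) x = conformalFactor Q A x ^ 2 • formB Q := by
    have hτx := (hdom x).mp hx
    -- The factor is `τ⁻¹` up to the sign `ε`, which squaring removes.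
    have hsq : conformalFactor Q A x ^ 2 = (τ x)⁻¹ ^ 2 := by
      rw [hfac x hx, div_pow, mul_pow, mul_pow, hε]
      field_simp
    have hd := Q.apply_fderiv_of_apply_sub hopen (φ := moebiusMap Q A) (k := fun x => (τ x)⁻¹) hx
      ((hsm.contDiffAt (hopen.mem_nhds hx)).differentiableAt (by simp))
      (hτs.continuous.continuousAt.inv₀ hτx) fun y hy => by
        rw [hmap x hx, hmap y hy, ← hatQ_nullLift_sub Q y x, ← hiso, map_sub L]
        exact apply_sub_of_hatQ_eq_zero ((hiso _).trans (hatQ_nullLift Q y))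
          ((hiso _).trans (hatQ_nullLift Q x)) ((hdom y).mp hy) hτx
    refine LinearMap.ext₂ fun u v => ?_
    rw [LinearMap.smul_apply, LinearMap.smul_apply, smul_eq_mul, hsq, formB_apply]
    change formB Q (fderiv ℝ (moebiusMap Q A) x u) (fderiv ℝ (moebiusMap Q A) x v) = _
    rw [formB_apply, ← map_add, hd, hd, hd]
    ring
  refine ⟨hopen, fun x hx => by rw [hmap x hx, hquot x hx], hsm,
    ⟨N, hN, hdet, fun x hx => ⟨_, mul_ne_zero hk ((hdom x).mp hx), hden x hx, hfac x hx⟩⟩,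
    hfs, hpull, fun U hU hUo hUc => ⟨hUo, hUc, hsm.mono hU,
      -- `Ω_A` may be negative; its absolute value stays smooth because it never vanishes.
      fun x => |conformalFactor Q A x|, fun x hx => ?_, fun x hx => abs_pos.mpr (hfac0 x (hU hx)),
      fun x hx => by rw [sq_abs]; exact hpull x (hU hx)⟩⟩
  exact (contDiffAt_abs (hfac0 x (hU hx))).comp_contDiffWithinAt x ((hfs x (hU hx)).mono hU)
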